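/- Conventions. A metric space $X$ is geodesic if any two of its points are joined by a geodesic segment, and $\delta$-hyperbolic if $(x,z)_p\ge\min\{(x,y)_p,(y,z)_p\}-\delta$ for all $p,x,y,z\in X$, where $(x,y)_p=\frac12(d(x,p)+d(y,p)-d(x,y))$. Its ideal boundary $\partial X$ is the set of classes of sequences $(u_n)$ with $(u_i,u_j)_p\to\infty$ as $i,j\to\infty$, where $(u_n)\sim(v_n)$ if $(u_n,v_n)_p\to\infty$. A geodesic is an isometric embedding $\gamma:\mathbb R\to X$ (identified below with its image). The space $X$ is geodesically rich with constants $r_0,\dots,r_4\ge 0$ if (i) for all $p,q\in X$ with $d(p,q)\ge r_0$ there is a geodesic $\gamma$ with $d(p,\gamma)<r_1$ and $|d(q,\gamma)-d(q,p)|<r_2$; (ii) for every geodesic $\gamma$ and every $p\in X$ there is a geodesic $\gamma'$ with $d(p,\gamma')\le r_3$ and $|d(p,\gamma)-d(\gamma',\gamma)|\le r_4$, where $d(\gamma',\gamma)=\inf\{d(a,b):a\in\gamma',\,b\in\gamma\}$. A map $f:X\to X$ is a $(\lambda,c)$-self-quasi-isometry if $\frac1\lambda d(x,y)-c\le d(f(x),f(y))\le\lambda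 d(x,y)+c$ for all $x,y\in X$. It fixes $\partial X$ if, whenever a sequence $(u_n)$ represents $\xi\in\partial X$, the sequence $(f(u_n))$ also represents $\xi$. Theorem. For every $\lambda_0>1$ there is a constant $A\ge 0$, depending only on $\lambda_0$, such that the following holds for every geodesic $\delta$-hyperbolic metric space $X$ which is geodesically rich with constants $r_0,\dots,r_4$. (a) For all $\lambda\ge\lambda_0$ and all $c$, every $(\lambda,c)$-self-quasi-isometry $f$ of $X$ fixing $\partial X$, and every point $O\in X$, $$d(O,f(O))\le\max\bigl(r_0,\ \lambda\,(r_3+c+c_1\ln\lambda)\bigr)+r_1+r_2+r_4,\qquad c_1=A(c+\delta).$$ (b) There is a constant $A_4$, depending only on $X$ (with its constants $\delta,r_0,\dots,r_4$) and on $\lambda_0$, such that for all such $\lambda$, $c$, $f$ and $O$, $$d(O,f(O))\le\max\bigl(r_0,\ (A_4+A\,c)\,\lambda\ln\lambda\bigr).$$ -/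

import Mathlib

open Filter

namespace HypDisplacement

variable {X : Type*} [MetricSpace X]

/-- Gromov's product `(x, y)_p`. -/
noncomputable def gromovProduct (x y p : X) : ℝ :=
  (dist x p + dist y p - dist x y) / 2

variable (X) in
/-- The four-point condition of Gromov. -/
def IsHyperbolic (δ : ℝ) : Prop :=
  ∀ p x y z : X,
    min (gromovProduct x y p) (gromovProduct y z p) - δ ≤ gromovProduct x z p

variable (X) in
/-- Any two points are joined by a geodesic segment. -/
def IsGeodesicSpace : Prop :=
  ∀ x y : X, ∃ γ : ℝ → X, γ 0 = x ∧ γ (dist x y) = y ∧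
    ∀ s ∈ Set.Icc 0 (dist x y), ∀ t ∈ Set.Icc 0 (dist x y), dist (γ s) (γ t) = |s - t|

/-- A (complete) geodesic is an isometric embedding of the real line. -/
def IsGeodesic (γ : ℝ → X) : Prop := Isometry γ

/-- The distance `inf {d(a, b) : a ∈ S, b ∈ T}` between two (non-empty) sets. -/
noncomputable def setDist (S T : Set X) : ℝ := ⨅ q : S × T, dist (q.1 : X) (q.2 : X)

/-- `(lam, c)`-quasi-isometry: the two-sided inequality, without coarse surjectivity. -/
def IsQuasiIsometry {Y : Type*} [MetricSpace Y] (lam c : ℝ) (f : X → Y) : Prop :=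
  ∀ x y : X, dist x y / lam - c ≤ dist (f x) (f y) ∧ dist (f x) (f y) ≤ lam * dist x y + c

variable (X) in
/-- Geodesic richness with prescribed (non-negative) constants. -/
structure IsGeodesicallyRich (r₀ r₁ r₂ r₃ r₄ : ℝ) : Prop where
  nonneg : 0 ≤ r₀ ∧ 0 ≤ r₁ ∧ 0 ≤ r₂ ∧ 0 ≤ r₃ ∧ 0 ≤ r₄
  exists_far : ∀ p q : X, r₀ ≤ dist p q → ∃ γ : ℝ → X, IsGeodesic γ ∧
    Metric.infDist p (Set.range γ) < r₁ ∧ |Metric.infDist q (Set.range γ) - dist q p| < r₂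
  exists_near : ∀ γ : ℝ → X, IsGeodesic γ → ∀ p : X, ∃ γ' : ℝ → X, IsGeodesic γ' ∧
    Metric.infDist p (Set.range γ') ≤ r₃ ∧
    |Metric.infDist p (Set.range γ) - setDist (Set.range γ') (Set.range γ)| ≤ r₄

/-- `u` converges at infinity: `(u i, u j)_p → ∞` as `i, j → ∞`
(for one, equivalently for every, base point `p`). -/
def ConvergesAtInfinity (u : ℕ → X) : Prop :=
  ∀ p : X, Tendsto (fun k : ℕ × ℕ => gromovProduct (u k.1) (u k.2) p) atTop atTop

variable (X) in
/-- The sequences converging at infinity. -/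
def SeqAtInfinity : Type _ := {u : ℕ → X // ConvergesAtInfinity u}

lemma gromovProduct_comm (x y p : X) : gromovProduct x y p = gromovProduct y x p := by
  unfold gromovProduct; rw [dist_comm x y]; ring

/-- Equivalence of sequences converging at infinity: `(u n, v n)_p → ∞`. -/
def boundarySetoid {δ : ℝ} (h : IsHyperbolic X δ) : Setoid (SeqAtInfinity X) where
  r u v := ∀ p : X, Tendsto (fun n => gromovProduct (u.1 n) (v.1 n) p) atTop atTop
  iseqv :=
    { refl := fun u p => (u.2 p).comp tendsto_atTop_diagonal
      symm := fun {u v} huv p => by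
        simpa only [gromovProduct_comm] using huv p
      trans := fun {u v w} huv hvw p => by
        refine tendsto_atTop_mono (fun n => h p (u.1 n) (v.1 n) (w.1 n)) ?_
        refine tendsto_atTop_add_const_right _ (-δ) (tendsto_atTop.2 fun b => ?_)
        filter_upwards [(huv p).eventually_ge_atTop b, (hvw p).eventually_ge_atTop b]
          with n h1 h2 using le_min h1 h2 }

/-- The ideal boundary of a hyperbolic space. -/
def IdealBoundary {δ : ℝ} (h : IsHyperbolic X δ) : Type _ := Quotient (boundarySetoid h)

/-- The boundary point to which a sequence converging at infinity converges. -/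
def IdealBoundary.limit {δ : ℝ} (h : IsHyperbolic X δ) (u : ℕ → X)
    (hu : ConvergesAtInfinity u) : IdealBoundary h :=
  Quotient.mk (boundarySetoid h) ⟨u, hu⟩

/-- `f` fixes every point of the ideal boundary: if `u` converges to a boundary point,
then `f ∘ u` converges to the same boundary point. -/
def FixesIdealBoundary {δ : ℝ} (h : IsHyperbolic X δ) (f : X → X) : Prop :=
  ∀ (u : ℕ → X) (hu : ConvergesAtInfinity u), ∃ hfu : ConvergesAtInfinity (f ∘ u),
    IdealBoundary.limit h (f ∘ u) hfu = IdealBoundary.limit h u hu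

end HypDisplacement

/-!
The heart of the matter is an "anti-Morse" estimate: if `f` is a `(lam, c)`-quasi-isometry fixing the
ideal boundary and `γ` is a geodesic line, then every point `z` of `γ` is within
`A (c + δ) log lam` of the image `f ∘ γ` (`infDist_range_comp_geodesic_le`).

Let `D` be the distance from `z` to `f ∘ γ`. Since `f` fixes the two ends of `γ`, far away points of
`f ∘ γ` on both sides have Gromov product at most `2δ` seen from `z`. On the other hand this product
can be bounded from below along the curve. Cut the curve into blocks of parameter length
`T ≈ lam * D`, starting from a point almost nearest to `z`; repeated halving of a block costs only
logarithmically many multiples of `δ` (`le_gromovProduct_of_subdivision`), and since the blocks move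
away from `z` at a linear rate, infinitely many of them can be concatenated at the price of one
further `δ` (`le_gromovProduct_of_linear_growth`). The result is
`D ≤ O(c + δ) + δ log₂ (lam² (1 + D / (c + δ)))`, which forces `D ≤ A (c + δ) log lam`.

For the theorem, let `d(O, f O) ≥ r₀`. Richness yields a geodesic `γ` passing near `O` and
far from `f O`, and then a geodesic `γ'` passing near `f O` and far from `γ`. By the estimate, some
`w ∈ γ'` has `f w` close to `f O`, so `w` is close to `O` because `f` is a quasi-isometry; but
`d(O, w)` is at least about `d(γ, γ')`, hence at least about `d(O, f O)`.
-/

namespace HypDisplacement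

variable {X : Type*} [MetricSpace X]

lemma IsHyperbolic.nonneg {δ : ℝ} (h : IsHyperbolic X δ) (p : X) : 0 ≤ δ := by
  have := h p p p p
  simp [gromovProduct] at this
  exact this

lemma IsQuasiIsometry.nonneg {lam c : ℝ} {f : X → X} (h : IsQuasiIsometry lam c f) (p : X) :
    0 ≤ c := by
  have := (h p p).1
  simp at this
  exact this

/-! ### Gromov products along curves -/

lemma le_gromovProduct {x y z : X} {E m : ℝ} (hx : E ≤ dist z x) (hy : E ≤ dist z y)
    (hxy : dist x y ≤ 2 * m) : E - m ≤ gromovProduct x y z := by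
  unfold gromovProduct
  rw [dist_comm x z, dist_comm y z]
  linarith

/-- If consecutive Gromov products grow at least by `δ` per step, the whole chain loses only one
`δ`: the point `y i` is split off first, so the `j`-th link is paid for `j - i + 1` times. -/
lemma le_gromovProduct_of_linear_growth {δ : ℝ} (h : IsHyperbolic X δ) {z : X} {y : ℕ → X} {a : ℝ}
    (hy : ∀ i : ℕ, a + i * δ ≤ gromovProduct (y i) (y (i + 1)) z) (n i : ℕ) :
    a + i * δ - δ ≤ gromovProduct (y i) (y (i + n + 1)) z := by
  induction n generalizing i with
  | zero => linarith [hy i, h.nonneg z, Nat.add_zero i]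
  | succ n ih =>
    have h1 := h z (y i) (y (i + 1)) (y (i + (n + 1) + 1))
    have h2 := ih (i + 1)
    rw [show i + 1 + n + 1 = i + (n + 1) + 1 by ring] at h2
    push_cast at h2
    have h3 := le_min (hy i) (show a + i * δ ≤ _ by linarith)
    linarith

/-- Halving a parameter interval `k` times costs `k * δ`. -/
lemma le_gromovProduct_of_subdivision {δ : ℝ} (h : IsHyperbolic X δ) {z : X} {g : ℝ → X} {a : ℝ}
    (k : ℕ) {s t : ℝ} (hst : s ≤ t)
    (hg : ∀ u ∈ Set.Icc s t, ∀ v ∈ Set.Icc s t, |u - v| ≤ (t - s) / 2 ^ k →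
      a ≤ gromovProduct (g u) (g v) z) :
    a - k * δ ≤ gromovProduct (g s) (g t) z := by
  induction k generalizing s t with
  | zero =>
    have := hg s ⟨le_rfl, hst⟩ t ⟨hst, le_rfl⟩
      (by rw [abs_sub_comm, abs_of_nonneg (sub_nonneg.2 hst)]; simp)
    simpa using this
  | succ k ih =>
    have h1 := ih (s := s) (t := (s + t) / 2) (by linarith) fun u hu v hv huv =>
      hg u ⟨hu.1, by linarith [hu.2]⟩ v ⟨hv.1, by linarith [hv.2]⟩
        (huv.trans_eq (by rw [pow_succ]; field_simp; ring))
    have h2 := ih (s := (s + t) / 2) (t := t) (by linarith) fun u hu v hv huv =>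
      hg u ⟨by linarith [hu.1], hu.2⟩ v ⟨by linarith [hv.1], hv.2⟩
        (huv.trans_eq (by rw [pow_succ]; field_simp; ring))
    have h3 := h z (g s) (g ((s + t) / 2)) (g t)
    have h4 := le_min h1 h2
    push_cast
    linarith

/-- Lower bound for the Gromov product of the starting point of a coarsely Lipschitz ray and a far
away point of it, when the ray stays at distance `D` from `z` and escapes at linear rate `1 / lam`.
The scale `m` dominates both `δ` and the additive constant of the ray. -/
lemma le_gromovProduct_ray {δ lam c D m : ℝ} (h : IsHyperbolic X δ) (hlam : 0 < lam) (hm : 0 < m)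
    (hcm : c ≤ m) (hδm : δ ≤ m) (hD : 0 ≤ D) {z : X} {g : ℝ → X} {k : ℕ}
    (hk : lam ^ 2 * (2 * D + 2 * m) / m ≤ 2 ^ k)
    (hg : ∀ s t, dist (g s) (g t) ≤ lam * |s - t| + c)
    (hgD : ∀ s, D ≤ dist z (g s))
    (hgl : ∀ s, 0 ≤ s → s / lam - D - 2 * m ≤ dist z (g s)) (n : ℕ) :
    D - m - (k + 2) * δ ≤ gromovProduct (g 0) (g (n * (lam * (2 * D + 2 * m)))) z := by
  have hδ := h.nonneg z
  set T := lam * (2 * D + 2 * m) with hT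
  have hT0 : 0 < T := by positivity
  rcases n with _ | n
  · have := le_gromovProduct (m := 0) (hgD 0) (hgD 0) (by simp)
    have h2 : 0 ≤ (k + 2) * δ := by positivity
    simp only [Nat.cast_zero, zero_mul]
    linarith
  -- the block `[i T, (i + 1) T]` is at distance at least `D + (i - 1) δ` from `z`
  have key : ∀ i : ℕ, (D - m - (k + 1) * δ) + i * δ ≤
      gromovProduct (g ((i : ℕ) * T)) (g ((i + 1 : ℕ) * T)) z := by
    intro i
    have hfar : ∀ u, i * T ≤ u → D + (i - 1) * δ ≤ dist z (g u) := by
      intro u hu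
      rcases i with _ | i
      · have := hgD u
        push_cast
        linarith
      · have hu0 : 0 ≤ u := le_trans (by positivity) hu
        have h1 := hgl u hu0
        have h2 : ((i + 1 : ℕ) : ℝ) * (2 * D + 2 * m) ≤ u / lam := by
          rw [le_div_iff₀ hlam]
          calc _ = ((i + 1 : ℕ) : ℝ) * T := by rw [hT]; ring
            _ ≤ u := hu
        have h3 : (i : ℝ) * δ ≤ i * (2 * D + 2 * m) :=
          mul_le_mul_of_nonneg_left (by linarith) (Nat.cast_nonneg i)
        push_cast at h2 ⊢
        linarith
    have := le_gromovProduct_of_subdivision h (z := z) (g := g) (a := D + (i - 1) * δ - m) k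
      (s := (i : ℕ) * T) (t := (i + 1 : ℕ) * T) (by push_cast; linarith) (by
        intro u hu v hv huv
        refine le_gromovProduct (hfar u hu.1) (hfar v hv.1) ((hg u v).trans ?_)
        have h1 : lam * |u - v| ≤ m := by
          calc lam * |u - v| ≤ lam * ((((i + 1 : ℕ) : ℝ) * T - i * T) / 2 ^ k) := by gcongr
            _ = lam ^ 2 * (2 * D + 2 * m) / 2 ^ k := by push_cast; rw [hT]; ring
            _ ≤ m := by
              rw [div_le_iff₀ hm] at hk
              rw [div_le_iff₀ (by positivity)]
              linarith
        linarith)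
    linarith
  have := le_gromovProduct_of_linear_growth h (y := fun i : ℕ => g (i * T)) key n 0
  simp only [Nat.cast_zero, zero_mul, zero_add, add_zero] at this ⊢
  linarith

/-! ### Geodesic lines and the ideal boundary -/

lemma IsGeodesic.convergesAtInfinity {γ : ℝ → X} (hγ : IsGeodesic γ) {s : ℕ → ℝ}
    (hs : Tendsto s atTop atTop) : ConvergesAtInfinity fun n => γ (s n) := by
  intro p
  have hlow : ∀ k : ℕ × ℕ, min (s k.1) (s k.2) - dist p (γ 0) ≤
      gromovProduct (γ (s k.1)) (γ (s k.2)) p := by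
    intro k
    have h1 : ∀ t, t - dist p (γ 0) ≤ dist (γ t) p := by
      intro t
      have h2 := dist_triangle (γ t) p (γ 0)
      rw [hγ.dist_eq, Real.dist_eq, sub_zero] at h2
      linarith [le_abs_self t]
    have h3 := h1 (s k.1)
    have h4 := h1 (s k.2)
    have h5 : dist (γ (s k.1)) (γ (s k.2)) = |s k.1 - s k.2| := by
      rw [hγ.dist_eq, Real.dist_eq]
    unfold gromovProduct
    rw [h5]
    rcases le_total (s k.1) (s k.2) with h6 | h6
    · rw [min_eq_left h6, abs_of_nonpos (by linarith)]
      linarith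
    · rw [min_eq_right h6, abs_of_nonneg (by linarith)]
      linarith
  refine tendsto_atTop_mono hlow (tendsto_atTop_add_const_right _ _ (tendsto_atTop.2 fun b => ?_))
  rw [← prod_atTop_atTop_eq]
  filter_upwards [((hs.eventually_ge_atTop b).prod_mk (hs.eventually_ge_atTop b))] with k hk
  exact le_min hk.1 hk.2

lemma FixesIdealBoundary.tendsto_gromovProduct {δ : ℝ} {h : IsHyperbolic X δ} {f : X → X}
    (hf : FixesIdealBoundary h f) {u : ℕ → X} (hu : ConvergesAtInfinity u) (p : X) :
    Tendsto (fun n => gromovProduct (f (u n)) (u n) p) atTop atTop := by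
  obtain ⟨hfu, heq⟩ := hf u hu
  exact Quotient.exact heq p

/-- A self-map fixing the ideal boundary moves the far away points of a geodesic line to points
which are almost opposite as seen from any point of that line. -/
lemma exists_gromovProduct_comp_geodesic_le {δ : ℝ} (h : IsHyperbolic X δ) {f : X → X}
    (hf : FixesIdealBoundary h f) {γ : ℝ → X} (hγ : IsGeodesic γ) (b t₀ : ℝ) {T : ℝ} (hT : 0 < T) :
    ∃ n : ℕ, gromovProduct (f (γ (t₀ + n * T))) (f (γ (t₀ - n * T))) (γ b) ≤ 2 * δ := by
  have hs : Tendsto (fun n : ℕ => (n : ℝ) * T) atTop atTop :=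
    tendsto_natCast_atTop_atTop.atTop_mul_const hT
  have hγ' : IsGeodesic fun t => γ (-t) := hγ.comp (IsometryEquiv.neg ℝ).isometry
  have hplus := tendsto_atTop_add_const_left _ t₀ hs
  have hminus := tendsto_atTop_add_const_left _ (-t₀) hs
  have h1 := hf.tendsto_gromovProduct (hγ.convergesAtInfinity hplus) (γ b)
  have h2 := hf.tendsto_gromovProduct (hγ'.convergesAtInfinity hminus) (γ b)
  obtain ⟨n, h3, h4, h5, h6⟩ := ((h1.eventually_gt_atTop (2 * δ)).and
    ((h2.eventually_gt_atTop (2 * δ)).and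
      ((hplus.eventually_ge_atTop b).and (hminus.eventually_ge_atTop (-b))))).exists
  refine ⟨n, ?_⟩
  simp only [neg_add_rev, neg_neg] at h4
  rw [show -((n : ℝ) * T) + t₀ = t₀ - n * T by ring] at h4
  have h0 : gromovProduct (γ (t₀ + n * T)) (γ (t₀ - n * T)) (γ b) = 0 := by
    unfold gromovProduct
    simp only [hγ.dist_eq, Real.dist_eq]
    rw [abs_of_nonneg (by linarith), abs_of_nonpos (by linarith), abs_of_nonneg (by linarith)]
    ring
  have hδ := h.nonneg (γ b)
  have h7 := h (γ b) (γ (t₀ + n * T)) (f (γ (t₀ + n * T))) (γ (t₀ - n * T))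
  have h8 := h (γ b) (f (γ (t₀ + n * T))) (f (γ (t₀ - n * T))) (γ (t₀ - n * T))
  rw [gromovProduct_comm (γ (t₀ + n * T)) (f (γ (t₀ + n * T)))] at h7
  by_contra! hlt
  have h9 := lt_min hlt h4
  have h10 := lt_min (show δ < gromovProduct (f (γ (t₀ + n * T))) (γ (t₀ + n * T)) (γ b) by linarith)
    (show δ < gromovProduct (f (γ (t₀ + n * T))) (γ (t₀ - n * T)) (γ b) by linarith)
  linarith

/-! ### Geodesics are close to their quasi-isometric images -/

/-- The self-bounding estimate for the distance `D` of a point of the geodesic `γ` to `f ∘ γ`. -/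
lemma infDist_range_comp_geodesic_le_of_le_two_pow {δ lam c m : ℝ} (h : IsHyperbolic X δ)
    (hlam : 0 < lam) (hm : 0 < m) (hcm : c ≤ m) (hδm : δ ≤ m) {f : X → X}
    (hqi : IsQuasiIsometry lam c f) (hf : FixesIdealBoundary h f) {γ : ℝ → X} (hγ : IsGeodesic γ)
    (b : ℝ) {k : ℕ}
    (hk : lam ^ 2 * (2 * Metric.infDist (γ b) (Set.range (f ∘ γ)) + 2 * m) / m ≤ 2 ^ k) :
    Metric.infDist (γ b) (Set.range (f ∘ γ)) ≤ m + (k + 5) * δ := by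
  set D := Metric.infDist (γ b) (Set.range (f ∘ γ)) with hDdef
  have hD : 0 ≤ D := Metric.infDist_nonneg
  have hDle : ∀ t, D ≤ dist (γ b) (f (γ t)) := fun t =>
    Metric.infDist_le_dist_of_mem (Set.mem_range_self (f := f ∘ γ) t)
  obtain ⟨_, ⟨t₀, rfl⟩, ht₀⟩ :=
    (Metric.infDist_lt_iff (Set.range_nonempty (f ∘ γ))).1 (show D < D + m by linarith)
  have hup : ∀ s t, dist (f (γ s)) (f (γ t)) ≤ lam * |s - t| + c := fun s t => by
    simpa [hγ.dist_eq, Real.dist_eq] using (hqi (γ s) (γ t)).2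
  have hlow : ∀ t, |t - t₀| / lam - D - 2 * m ≤ dist (γ b) (f (γ t)) := fun t => by
    have h1 := (hqi (γ t) (γ t₀)).1
    rw [hγ.dist_eq, Real.dist_eq] at h1
    have h2 := dist_triangle_left (f (γ t)) (f (γ t₀)) (γ b)
    simp only [Function.comp_apply] at ht₀
    linarith
  set T := lam * (2 * D + 2 * m) with hT
  obtain ⟨n, hn⟩ := exists_gromovProduct_comp_geodesic_le h hf hγ b t₀
    (show 0 < T by positivity)
  have hright := le_gromovProduct_ray h hlam hm hcm hδm hD (z := γ b)
    (g := fun s => f (γ (t₀ + s))) hk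
    (fun s t => by simpa using hup (t₀ + s) (t₀ + t)) (fun s => hDle _)
    (fun s hs => by simpa [abs_of_nonneg hs] using hlow (t₀ + s)) n
  have hleft := le_gromovProduct_ray h hlam hm hcm hδm hD (z := γ b)
    (g := fun s => f (γ (t₀ - s))) hk
    (fun s t => by simpa [abs_sub_comm] using hup (t₀ - s) (t₀ - t)) (fun s => hDle _)
    (fun s hs => by simpa [abs_of_nonneg hs] using hlow (t₀ - s)) n
  simp only [add_zero, sub_zero, ← hT] at hright hleft
  rw [gromovProduct_comm] at hright
  have h1 := h (γ b) (f (γ (t₀ + n * T))) (f (γ t₀)) (f (γ (t₀ - n * T)))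
  have h2 := le_min hright hleft
  linarith

/-- The self-bounding inequality `x ≤ 7 + log₂ (lam² (2 x + 2))`, written with an integer
`k` in place of the logarithm rounded up, bounds `x` logarithmically in `lam`. -/
lemma le_of_le_logb {x lam : ℝ} (hx : 0 ≤ x) (hlam : 1 ≤ lam)
    (H : ∀ k : ℕ, lam ^ 2 * (2 * x + 2) ≤ 2 ^ k → x ≤ k + 6) :
    x ≤ 19 + 4 * Real.logb 2 lam := by
  have hlam0 : 0 < lam := by linarith
  set y := lam ^ 2 * (2 * x + 2) with hy
  have hy1 : 1 ≤ y := by nlinarith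
  have hle : y ≤ 2 ^ ⌈Real.logb 2 y⌉₊ := by
    rw [← Real.rpow_natCast]
    calc y = (2 : ℝ) ^ Real.logb 2 y :=
          (Real.rpow_logb (by norm_num) (by norm_num) (by linarith)).symm
      _ ≤ _ := Real.rpow_le_rpow_of_exponent_le (by norm_num) (Nat.le_ceil _)
  have h1 := H _ hle
  have h2 := Nat.ceil_lt_add_one (Real.logb_nonneg (by norm_num : (1 : ℝ) < 2) hy1)
  have h3 : Real.logb 2 y = 2 * Real.logb 2 lam + 2 + Real.logb 2 ((x + 1) / 2) := by
    rw [show y = lam ^ 2 * ((2 : ℝ) ^ 2 * ((x + 1) / 2)) by rw [hy]; ring,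
      Real.logb_mul (by positivity) (by positivity), Real.logb_mul (by positivity) (by positivity),
      Real.logb_pow, Real.logb_pow, Real.logb_self_eq_one (by norm_num)]
    push_cast
    ring
  -- `log₂ u ≤ u` for every `u > 0`, applied to `u = (x + 1) / 2`
  have h4 : Real.logb 2 ((x + 1) / 2) ≤ (x + 1) / 2 := by
    rw [Real.logb, div_le_iff₀ (Real.log_pos (by norm_num))]
    set u := (x + 1) / 2 with hu
    have hu0 : 0 < u := by positivity
    have h5 := Real.log_le_sub_one_of_pos (show 0 < u / 2 by positivity)
    rw [Real.log_div hu0.ne' (by norm_num)] at h5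
    nlinarith [Real.log_two_gt_d9, Real.log_two_lt_d9]
  linarith

/-- Every point of a geodesic line `γ` is within `A (c + δ) log lam` of `f ∘ γ`, with `A` depending
only on a lower bound `lam₀ > 1` for `lam`. -/
theorem infDist_range_comp_geodesic_le {δ lam₀ lam c : ℝ} (h : IsHyperbolic X δ) (hlam₀ : 1 < lam₀)
    (hlam : lam₀ ≤ lam) {f : X → X} (hqi : IsQuasiIsometry lam c f) (hf : FixesIdealBoundary h f)
    {γ : ℝ → X} (hγ : IsGeodesic γ) (b : ℝ) :
    Metric.infDist (γ b) (Set.range (f ∘ γ)) ≤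
      (19 / Real.log lam₀ + 4 / Real.log 2) * (c + δ) * Real.log lam := by
  have hδ := h.nonneg (γ b)
  have hc := hqi.nonneg (γ b)
  have hlog₀ : 0 < Real.log lam₀ := Real.log_pos hlam₀
  have hlog : Real.log lam₀ ≤ Real.log lam := Real.log_le_log (by linarith) hlam
  set D := Metric.infDist (γ b) (Set.range (f ∘ γ)) with hDdef
  have hD : 0 ≤ D := Metric.infDist_nonneg
  set M := (19 / Real.log lam₀ + 4 / Real.log 2) * Real.log lam with hM
  have hM_le : 19 + 4 * Real.logb 2 lam ≤ M := by
    have h1 : 19 ≤ 19 / Real.log lam₀ * Real.log lam := by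
      rw [div_mul_eq_mul_div, le_div_iff₀ hlog₀]
      linarith
    have h2 : 4 * Real.logb 2 lam = 4 / Real.log 2 * Real.log lam := by
      rw [Real.logb]; ring
    rw [hM, add_mul]
    linarith
  -- a positive scale is needed to subdivide, and `c + δ` may vanish
  have main : ∀ m, c + δ < m → D ≤ m * M := by
    intro m hcδm
    have hm : 0 < m := by linarith
    have hx := le_of_le_logb (x := D / m) (lam := lam) (by positivity) (by linarith) fun k hk => by
      have h1 := infDist_range_comp_geodesic_le_of_le_two_pow h (by linarith) hm
        (by linarith) (by linarith) hqi hf hγ b (k := k) (by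
          refine le_of_eq_of_le ?_ hk
          field_simp
          rfl)
      rw [div_le_iff₀ hm]
      have h2 : (k + 5 : ℝ) * δ ≤ (k + 5) * m :=
        mul_le_mul_of_nonneg_left (by linarith) (by positivity)
      linarith
    rw [div_le_iff₀ hm] at hx
    nlinarith
  have hMpos : 0 < M := by
    have : 0 < Real.log 2 := Real.log_pos (by norm_num)
    have : 0 < Real.log lam := hlog₀.trans_le hlog
    positivity
  have hfin : D / M ≤ c + δ := le_of_forall_gt_imp_ge_of_dense fun m hm =>
    (div_le_iff₀ hMpos).2 (main m hm)
  rw [div_le_iff₀ hMpos] at hfin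
  linarith

/-! ### Displacement in geodesically rich spaces -/

lemma setDist_le_dist {S T : Set X} {a b : X} (ha : a ∈ S) (hb : b ∈ T) : setDist S T ≤ dist a b :=
  ciInf_le (f := fun q : S × T => dist (q.1 : X) (q.2 : X))
    ⟨0, by rintro _ ⟨q, rfl⟩; exact dist_nonneg⟩ (⟨a, ha⟩, ⟨b, hb⟩)

/-- The displacement bound when every geodesic line is within `K` of its image. -/
lemma IsGeodesicallyRich.dist_le {r₀ r₁ r₂ r₃ r₄ lam c K : ℝ}
    (hrich : IsGeodesicallyRich X r₀ r₁ r₂ r₃ r₄) (hlam : 0 < lam) {f : X → X}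
    (hqi : IsQuasiIsometry lam c f)
    (hK : ∀ γ : ℝ → X, IsGeodesic γ → ∀ b, Metric.infDist (γ b) (Set.range (f ∘ γ)) ≤ K)
    {O : X} (hO : r₀ ≤ dist O (f O)) :
    dist O (f O) ≤ lam * (r₃ + c + K) + r₁ + r₂ + r₄ := by
  obtain ⟨γ, hγ, hOγ, hfOγ⟩ := hrich.exists_far O (f O) hO
  obtain ⟨γ', hγ', hfOγ', hdist⟩ := hrich.exists_near γ hγ (f O)
  obtain ⟨_, ⟨a, rfl⟩, ha⟩ := (Metric.infDist_lt_iff (Set.range_nonempty γ)).1 hOγ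
  have h1 := (abs_lt.1 hfOγ).1
  have h2 := (abs_le.1 hdist).2
  rw [dist_comm (f O) O] at h1
  refine le_of_forall_pos_le_add fun ε hε => ?_
  -- the distances to `γ'` and to `f ∘ γ'` are only approximated, each up to `η`
  obtain ⟨η, hη, hηε⟩ : ∃ η : ℝ, 0 < η ∧ lam * (2 * η) = ε :=
    ⟨ε / (2 * lam), by positivity, by field_simp⟩
  obtain ⟨_, ⟨b, rfl⟩, hb⟩ := (Metric.infDist_lt_iff (Set.range_nonempty γ')).1
    (show _ < r₃ + η by linarith)
  obtain ⟨_, ⟨w, rfl⟩, hw⟩ := (Metric.infDist_lt_iff (Set.range_nonempty (f ∘ γ'))).1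
    (show _ < K + η by linarith [hK γ' hγ' b])
  have h3 : dist (f O) (f (γ' w)) ≤ r₃ + K + 2 * η := by
    have := dist_triangle (f O) (γ' b) (f (γ' w))
    simp only [Function.comp_apply] at hw
    linarith
  have h4 : dist O (γ' w) ≤ lam * (r₃ + c + K + 2 * η) := by
    have := (hqi O (γ' w)).1
    rw [← div_le_iff₀' hlam]
    linarith
  have h5 : setDist (Set.range γ') (Set.range γ) ≤ dist (γ' w) (γ a) :=
    setDist_le_dist ⟨w, rfl⟩ ⟨a, rfl⟩
  have h6 := dist_triangle_left (γ' w) (γ a) O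
  rw [mul_add] at h4
  linarith

end HypDisplacement

theorem theorem3 (lam₀ : ℝ) (hlam₀ : 1 < lam₀) :
    ∃ A : ℝ, 0 ≤ A ∧
      ∀ (X : Type*) [MetricSpace X] (δ r₀ r₁ r₂ r₃ r₄ : ℝ)
        (_ : HypDisplacement.IsGeodesicSpace X)
        (hδ : HypDisplacement.IsHyperbolic X δ)
        (_ : HypDisplacement.IsGeodesicallyRich X r₀ r₁ r₂ r₃ r₄),
        (∀ (lam c : ℝ) (f : X → X), lam₀ ≤ lam →
          HypDisplacement.IsQuasiIsometry lam c f →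
          HypDisplacement.FixesIdealBoundary hδ f →
          ∀ O : X, dist O (f O) ≤
            max r₀ (lam * (r₃ + c + A * (c + δ) * Real.log lam)) + r₁ + r₂ + r₄) ∧
        (∃ A₄ : ℝ, ∀ (lam c : ℝ) (f : X → X), lam₀ ≤ lam →
          HypDisplacement.IsQuasiIsometry lam c f →
          HypDisplacement.FixesIdealBoundary hδ f →
          ∀ O : X, dist O (f O) ≤ max r₀ ((A₄ + A * c) * lam * Real.log lam)) := by
  have hlog₀ : 0 < Real.log lam₀ := Real.log_pos hlam₀
  have hlog2 : 0 < Real.log 2 := Real.log_pos (by norm_num)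
  set B := 19 / Real.log lam₀ + 4 / Real.log 2 with hB
  have hB0 : 0 ≤ B := by positivity
  -- the extra `1 / log lam₀` absorbs the term `lam * c` in the second bound
  refine ⟨B + 1 / Real.log lam₀, by positivity, ?_⟩
  intro X _ δ r₀ r₁ r₂ r₃ r₄ _ hδ hrich
  obtain ⟨hr₀, hr₁, hr₂, hr₃, hr₄⟩ := hrich.nonneg
  have bound : ∀ (lam c : ℝ) (f : X → X), lam₀ ≤ lam →
      HypDisplacement.IsQuasiIsometry lam c f → HypDisplacement.FixesIdealBoundary hδ f →
      ∀ O : X, r₀ ≤ dist O (f O) →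
        dist O (f O) ≤ lam * (r₃ + c + B * (c + δ) * Real.log lam) + r₁ + r₂ + r₄ :=
    fun lam c f hlam hqi hf O hO => hrich.dist_le (by linarith) hqi
      (fun γ hγ b => HypDisplacement.infDist_range_comp_geodesic_le hδ hlam₀ hlam hqi hf hγ b) hO
  refine ⟨fun lam c f hlam hqi hf O => ?_,
    (B + 1 / Real.log lam₀) * δ + (r₁ + r₂ + r₃ + r₄) / Real.log lam₀,
    fun lam c f hlam hqi hf O => ?_⟩
  all_goals
    have hδ0 := hδ.nonneg O
    have hc0 := hqi.nonneg O
    have hlam1 : 1 < lam := hlam₀.trans_le hlam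
    have hlog : Real.log lam₀ ≤ Real.log lam := Real.log_le_log (by linarith) hlam
    have hlogpos : 0 < Real.log lam := hlog₀.trans_le hlog
    rcases lt_or_ge (dist O (f O)) r₀ with hO | hO
  · linarith [le_max_left r₀ (lam * (r₃ + c + (B + 1 / Real.log lam₀) * (c + δ) * Real.log lam))]
  · refine (bound lam c f hlam hqi hf O hO).trans ?_
    gcongr
    refine le_trans ?_ (le_max_right _ _)
    gcongr
    exact le_add_of_nonneg_right (by positivity)
  · exact hO.le.trans (le_max_left _ _)
  · refine (bound lam c f hlam hqi hf O hO).trans (le_trans ?_ (le_max_right _ _))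
    have hratio : 1 ≤ Real.log lam / Real.log lam₀ := (one_le_div hlog₀).2 hlog
    have h1 : r₁ + r₂ + r₄ ≤ lam * (r₁ + r₂ + r₄) := le_mul_of_one_le_left (by positivity) hlam1.le
    have h2 : c + (r₁ + r₂ + r₃ + r₄) ≤
        (c + (r₁ + r₂ + r₃ + r₄)) * (Real.log lam / Real.log lam₀) :=
      le_mul_of_one_le_right (by positivity) hratio
    have h3 : 0 ≤ 1 / Real.log lam₀ * δ * Real.log lam := by positivity
    calc lam * (r₃ + c + B * (c + δ) * Real.log lam) + r₁ + r₂ + r₄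
        ≤ lam * (c + (r₁ + r₂ + r₃ + r₄) + B * (c + δ) * Real.log lam) := by linarith
      _ ≤ lam * ((c + (r₁ + r₂ + r₃ + r₄)) * (Real.log lam / Real.log lam₀)
            + B * (c + δ) * Real.log lam + 1 / Real.log lam₀ * δ * Real.log lam) := by
          exact mul_le_mul_of_nonneg_left (by linarith) (by linarith)
      _ = _ := by ring
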